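/- Let $n\ge 1$ and $r\ge 0$ be integers, write $\mathbb Z_n=\mathbb Z/n\mathbb Z$, let $\beta\in\mathbb Z_n$ and let $l=\gcd(\beta,n)$ (so $l=n$ if $\beta=0$). Let $$N_\beta=\bigl|\{X\in \mathrm{GL}_r(\mathbb Z_n) : \operatorname{tr} X=\beta\}\bigr|,$$ and for $m\ge 1$ and $k\in\mathbb Z$ let $C_m(k)=\sum_{j\in\mathbb Z_m^*}\exp(2\pi\sqrt{-1}\,jk/m)$ be the Ramanujan sum. Then $$N_\beta=\frac{1}{\varphi(n/l)}\,n^{\frac{r(r-1)}2-1}\sum_{d\mid n}C_{n/l}(d)\,C_n(d)^r\,\varphi(n/d)\,d^{\frac{r(r-1)}2}\prod_{\substack{p\mid n\\ p\nmid n/d}}\ \prod_{i=1}^r\frac{1-p^{-i}}{1-p^{-1}},$$ where $\varphi$ is Euler's totient function, $d$ runs over the positive divisors of $n$ and $p$ over the primes dividing $n$ but not $n/d$. -/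

import Mathlib

/-- The Ramanujan sum `C_n(k) = ∑ exp(2πi j k / n)`, the sum being over the residues `j` modulo `n`
that are prime to `n`, i.e. over representatives of the units of `ℤ/nℤ`. -/
noncomputable def ramanujanSum (n : ℕ) (k : ℤ) : ℂ :=
  ∑ j ∈ (Finset.range n).filter (fun j => Nat.Coprime j n),
    Complex.exp (2 * (Real.pi : ℂ) * Complex.I * ((j : ℂ) * (k : ℂ)) / (n : ℂ))

/-- `N_β`: the number of matrices in `GL_r(ℤ/nℤ)` with trace `β`. -/
noncomputable def numGLWithTrace (r n : ℕ) (β : ZMod n) : ℕ :=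
  Nat.card {X : Matrix.GeneralLinearGroup (Fin r) (ZMod n) //
    Matrix.trace (X : Matrix (Fin r) (Fin r) (ZMod n)) = β}

/-! Fourier inversion on `ZMod n` gives `n * N_β = ∑ t, e(-tβ/n) * S(t)`, where `S(t)` sums `e(t tr
X / n)` over `GL_r` (`mul_numGLWithTrace`). It remains to evaluate `S(t)`, which depends only on `d
= gcd(t, n)`, and then to sum `e(-tβ/n)` over each gcd class.

`traceCharSum_zmod` evaluates `S`. The Chinese remainder theorem reduces it to prime powers. For a
nontrivial `ψ`, let `I` be its kernel ideal. Averaging over left multiplication by unitriangular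
matrices kills every `X` whose entries below the diagonal are not all in `I`. As `I` lies in the
maximal ideal, the remaining `X` are invertible exactly when their diagonal entries are units. The
sum then factors over entries: a unit sum on the diagonal, `|R|` above it, `|I|` below it. For
trivial `ψ` the sum is `|GL_r|`, counted by reduction mod `p`; its deviation from the same product
is `invertibilityFactor`.

For `ψ = e(t · / n)` the unit sum is `C_n(d)` and `|I| = d`. The sums over gcd classes become
Ramanujan sums by averaging over units (`sum_gcd_eq_ramanujanSum`). -/

open Finset

section TraceSum

variable {R S : Type*} [CommRing R] [Fintype R] [CommRing S] [Fintype S]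

open Classical in
/-- The sum of `ψ (tr X)` over the `r × r` matrices `X` with invertible determinant. -/
noncomputable def traceCharSum (r : ℕ) (ψ : AddChar R ℂ) : ℂ :=
  ∑ X : Matrix (Fin r) (Fin r) R, if IsUnit X.det then ψ X.trace else 0

open Classical in
/-- The sum of `ψ` over the units. -/
noncomputable def unitCharSum (ψ : AddChar R ℂ) : ℂ :=
  ∑ x : R, if IsUnit x then ψ x else 0

/-- The largest ideal on which the additive character `ψ` is trivial. -/
def AddChar.kernelIdeal {R : Type*} [CommRing R] (ψ : AddChar R ℂ) : Ideal R where
  carrier := {a | ∀ x, ψ (a * x) = 1}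
  add_mem' {a b} ha hb x := by rw [add_mul, AddChar.map_add_eq_mul, ha x, hb x, one_mul]
  zero_mem' x := by simp
  smul_mem' c a ha x := by
    rw [smul_eq_mul, mul_comm c a, mul_assoc]
    exact ha _

lemma AddChar.mem_kernelIdeal {R : Type*} [CommRing R] {ψ : AddChar R ℂ} {a : R} :
    a ∈ ψ.kernelIdeal ↔ ∀ x, ψ (a * x) = 1 := Iff.rfl

open Classical in
lemma AddChar.sum_mul_eq_ite_kernelIdeal (ψ : AddChar R ℂ) (a : R) :
    ∑ y, ψ (y * a) = if a ∈ ψ.kernelIdeal then (Fintype.card R : ℂ) else 0 := by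
  have h : ∀ y, ψ (y * a) = ψ.mulShift a y := fun y => by rw [mulShift_apply, mul_comm]
  simp_rw [h]
  split_ifs with ha
  · have : ∀ y, ψ.mulShift a y = 1 := fun y => by rw [mulShift_apply]; exact ha y
    simp [this]
  · apply sum_eq_zero_of_ne_one
    intro h1
    apply ha
    intro x
    rw [← mulShift_apply, h1, one_apply]

/-! ### Averaging over unitriangular matrices -/

/-- The upper unitriangular matrix whose entries above the diagonal are those of `g`. -/
def upperUnitriangular {R : Type*} [CommRing R] {r : ℕ} (g : Fin r → Fin r → R) :
    Matrix (Fin r) (Fin r) R :=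
  Matrix.of fun i j => if i < j then g i j else if i = j then 1 else 0

lemma det_upperUnitriangular {R : Type*} [CommRing R] {r : ℕ} (g : Fin r → Fin r → R) :
    (upperUnitriangular g).det = 1 := by
  rw [Matrix.det_of_isUpperTriangular]
  · simp [upperUnitriangular]
  · intro i j hij
    have h : j < i := hij
    simp [upperUnitriangular, h.not_gt, h.ne']

lemma trace_upperUnitriangular_mul {R : Type*} [CommRing R] {r : ℕ} (g : Fin r → Fin r → R)
    (X : Matrix (Fin r) (Fin r) R) :
    (upperUnitriangular g * X).trace =
      X.trace + ∑ i, ∑ j, if i < j then g i j * X j i else 0 := by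
  simp only [Matrix.trace, Matrix.diag_apply, Matrix.mul_apply, ← Finset.sum_add_distrib]
  refine Finset.sum_congr rfl fun i _ => ?_
  have : X i i = ∑ j, if i = j then X j i else 0 := by simp
  rw [this, ← Finset.sum_add_distrib]
  refine Finset.sum_congr rfl fun j _ => ?_
  by_cases h : i < j
  · simp [upperUnitriangular, h, h.ne]
  · by_cases h' : i = j <;> simp [upperUnitriangular, h, h']

lemma sum_fun_fun_prod_prod {ι κ α : Type*} [Fintype ι] [DecidableEq ι] [Fintype κ] [DecidableEq κ]
    [Fintype α] (f : ι → κ → α → ℂ) :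
    ∑ g : ι → κ → α, ∏ i, ∏ j, f i j (g i j) = ∏ i, ∏ j, ∑ y, f i j y := by
  simp_rw [Fintype.prod_sum]

lemma AddChar.map_finset_sum_eq_prod {A ι : Type*} [AddCommMonoid A] (ψ : AddChar A ℂ) (s : Finset ι)
    (f : ι → A) : ψ (∑ i ∈ s, f i) = ∏ i ∈ s, ψ (f i) := by
  classical
  induction s using Finset.induction with
  | empty => simp
  | insert a s ha ih => rw [sum_insert ha, prod_insert ha, map_add_eq_mul, ih]

-- The sum factors over all pairs `(i, j)`, each factor with `i < j` being an orthogonality sum.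
-- Letting `g` range over full square arrays keeps the product rectangular; the unused entries
-- contribute only powers of `|R|`.
open Classical in
lemma sum_upperUnitriangular (ψ : AddChar R ℂ) {r : ℕ} (X : Matrix (Fin r) (Fin r) R) :
    ∑ g : Fin r → Fin r → R, ψ (∑ i, ∑ j, if i < j then g i j * X j i else 0) =
      if ∀ i j, i < j → X j i ∈ ψ.kernelIdeal then
        (Fintype.card (Fin r → Fin r → R) : ℂ) else 0 := by
  have h1 : ∀ g : Fin r → Fin r → R, ψ (∑ i, ∑ j, if i < j then g i j * X j i else 0) =
      ∏ i, ∏ j, ψ (if i < j then g i j * X j i else 0) := fun g => by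
    rw [AddChar.map_finset_sum_eq_prod]
    exact Finset.prod_congr rfl fun i _ => AddChar.map_finset_sum_eq_prod _ _ _
  simp_rw [h1]
  refine (sum_fun_fun_prod_prod fun i j y => ψ (if i < j then y * X j i else 0)).trans ?_
  have h2 : ∀ i j : Fin r, ∑ y, ψ (if i < j then y * X j i else 0) =
      if i < j → X j i ∈ ψ.kernelIdeal then (Fintype.card R : ℂ) else 0 := by
    intro i j
    by_cases h : i < j
    · simp only [h, if_true, true_imp_iff]
      exact ψ.sum_mul_eq_ite_kernelIdeal _
    · simp [h]
  simp_rw [h2]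
  split_ifs with h
  · rw [Finset.prod_congr rfl fun i _ => Finset.prod_congr rfl fun j _ => if_pos (h i j)]
    simp
  · push Not at h
    obtain ⟨i, j, hij, hX⟩ := h
    refine Finset.prod_eq_zero (mem_univ i) (Finset.prod_eq_zero (mem_univ j) ?_)
    simp [hij, hX]

open Classical in
/-- Averaging over the unitriangular group: only the matrices that are upper triangular modulo the
kernel ideal of `ψ` contribute. -/
lemma traceCharSum_eq_sum_triangular (r : ℕ) (ψ : AddChar R ℂ) :
    traceCharSum r ψ = ∑ X : Matrix (Fin r) (Fin r) R,
      if IsUnit X.det ∧ ∀ i j, i < j → X j i ∈ ψ.kernelIdeal then ψ X.trace else 0 := by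
  have hcard : (Fintype.card (Fin r → Fin r → R) : ℂ) ≠ 0 := by
    exact_mod_cast Fintype.card_ne_zero
  apply mul_left_cancel₀ hcard
  have key : ∀ g : Fin r → Fin r → R, traceCharSum r ψ = ∑ X : Matrix (Fin r) (Fin r) R,
      if IsUnit X.det then ψ X.trace *
        ψ (∑ i, ∑ j, if i < j then g i j * X j i else 0) else 0 := by
    intro g
    have hu : IsUnit (upperUnitriangular g) := by
      rw [Matrix.isUnit_iff_isUnit_det, det_upperUnitriangular]; exact isUnit_one
    -- Substituting `g * X` for `X` preserves the determinant and shifts only the trace.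
    rw [traceCharSum, ← Equiv.sum_comp (Units.mulLeft hu.unit)]
    refine Finset.sum_congr rfl fun X _ => ?_
    simp only [Units.mulLeft_apply, IsUnit.unit_spec, Matrix.det_mul, det_upperUnitriangular,
      one_mul, trace_upperUnitriangular_mul, AddChar.map_add_eq_mul]
  calc (Fintype.card (Fin r → Fin r → R) : ℂ) * traceCharSum r ψ
      = ∑ _g : Fin r → Fin r → R, traceCharSum r ψ := by simp
    _ = ∑ g : Fin r → Fin r → R, ∑ X : Matrix (Fin r) (Fin r) R,
      if IsUnit X.det then ψ X.trace *
        ψ (∑ i, ∑ j, if i < j then g i j * X j i else 0) else 0 :=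
        Finset.sum_congr rfl fun g _ => key g
    _ = _ := by
      rw [Finset.sum_comm, Finset.mul_sum]
      refine Finset.sum_congr rfl fun X _ => ?_
      by_cases hX : IsUnit X.det
      · simp only [hX, if_true, true_and]
        rw [← Finset.mul_sum, sum_upperUnitriangular]
        split_ifs <;> ring
      · simp [hX]

lemma prod_prod_triangular (r : ℕ) (a b c : ℂ) :
    ∏ i : Fin r, ∏ j : Fin r, (if i = j then a else if i < j then b else c) =
      a ^ r * (b * c) ^ r.choose 2 := by
  induction r with
  | zero => simp
  | succ r ih =>
    rw [Fin.prod_univ_succ]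
    simp_rw [Fin.prod_univ_succ (n := r)]
    simp only [Fin.succ_inj, Fin.succ_lt_succ_iff, Finset.prod_mul_distrib, ih]
    simp [Fin.succ_ne_zero, (Fin.succ_ne_zero _).symm, Fin.succ_pos, Nat.choose_succ_succ' r 1]
    ring

/-! ### Nontrivial characters of a local ring -/

variable {k : Type*} [Field k]

/-- An element outside `ker f` is a unit, and an ideal containing a unit would force `ψ` to be
trivial. -/
lemma kernelIdeal_le_ker {R : Type*} [CommRing R] (f : R →+* k) [IsLocalHom f] {ψ : AddChar R ℂ}
    (hψ : ψ ≠ 1) : ψ.kernelIdeal ≤ RingHom.ker f := by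
  intro a ha
  rw [RingHom.mem_ker]
  by_contra hfa
  have hu : IsUnit a := isUnit_of_map_unit f a (isUnit_iff_ne_zero.mpr hfa)
  apply hψ
  ext x
  obtain ⟨u, rfl⟩ := hu
  have := AddChar.mem_kernelIdeal.mp ha (↑u⁻¹ * x)
  rwa [Units.mul_inv_cancel_left] at this

lemma isUnit_det_iff_of_triangular {R : Type*} [CommRing R] (f : R →+* k) [IsLocalHom f] {r : ℕ}
    (X : Matrix (Fin r) (Fin r) R) (hX : ∀ i j, i < j → X j i ∈ RingHom.ker f) :
    IsUnit X.det ↔ ∀ i, IsUnit (X i i) := by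
  have hu : ∀ x : R, IsUnit x ↔ f x ≠ 0 := fun x => by
    rw [← isUnit_iff_ne_zero, isUnit_map_iff]
  simp_rw [hu]
  rw [RingHom.map_det, Matrix.det_of_isUpperTriangular, Finset.prod_ne_zero_iff]
  · simp
  · intro i j hij
    exact hX j i hij

open Classical in
/-- The factor at the entry `(i, j)` of the summand attached to a matrix that is upper triangular
modulo the kernel ideal. -/
noncomputable def entryFactor (ψ : AddChar R ℂ) {r : ℕ} (i j : Fin r) (x : R) : ℂ :=
  if i = j then (if IsUnit x then ψ x else 0) else
    if i < j then 1 else if x ∈ ψ.kernelIdeal then 1 else 0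

open Classical in
lemma prod_entryFactor (f : R →+* k) [IsLocalHom f] {ψ : AddChar R ℂ} (hψ : ψ ≠ 1) {r : ℕ}
    (X : Matrix (Fin r) (Fin r) R) :
    ∏ i, ∏ j, entryFactor ψ i j (X i j) =
      if IsUnit X.det ∧ ∀ i j, i < j → X j i ∈ ψ.kernelIdeal then ψ X.trace else 0 := by
  by_cases hX : ∀ i j, i < j → X j i ∈ ψ.kernelIdeal
  · have h2 : ∀ i : Fin r, ∏ j, entryFactor ψ i j (X i j) =
        if IsUnit (X i i) then ψ (X i i) else 0 := by
      intro i
      rw [Finset.prod_eq_single i]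
      · simp [entryFactor]
      · intro j _ hji
        rcases lt_or_gt_of_ne hji with h | h
        · simp [entryFactor, h.ne', h.not_gt, hX j i h]
        · simp [entryFactor, h, h.ne]
      · simp
    simp_rw [h2]
    have hdet := isUnit_det_iff_of_triangular f X
      fun i j hij => kernelIdeal_le_ker f hψ (hX i j hij)
    by_cases hd : ∀ i, IsUnit (X i i)
    · rw [if_pos ⟨hdet.mpr hd, hX⟩, Matrix.trace, AddChar.map_finset_sum_eq_prod]
      exact Finset.prod_congr rfl fun i _ => if_pos (hd i)
    · rw [if_neg (fun h => hd (hdet.mp h.1))]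
      push Not at hd
      obtain ⟨i, hi⟩ := hd
      exact Finset.prod_eq_zero (mem_univ i) (if_neg hi)
  · rw [if_neg (fun h => hX h.2)]
    push Not at hX
    obtain ⟨i, j, hij, h⟩ := hX
    refine Finset.prod_eq_zero (mem_univ j) (Finset.prod_eq_zero (mem_univ i) ?_)
    simp [entryFactor, hij.ne', hij.not_gt, h]

/-- The sum over `GL_r` of a local ring of a nontrivial additive character of the trace. -/
lemma traceCharSum_of_ne_one (f : R →+* k) [IsLocalHom f] {ψ : AddChar R ℂ} (hψ : ψ ≠ 1) (r : ℕ) :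
    traceCharSum r ψ =
      unitCharSum ψ ^ r * ((Nat.card R : ℂ) * Nat.card ψ.kernelIdeal) ^ r.choose 2 := by
  classical
  rw [traceCharSum_eq_sum_triangular, Finset.sum_congr rfl
    fun X _ => (prod_entryFactor f hψ X).symm]
  refine (sum_fun_fun_prod_prod fun i j => entryFactor ψ i j).trans ?_
  rw [← prod_prod_triangular]
  refine Finset.prod_congr rfl fun i _ => Finset.prod_congr rfl fun j _ => ?_
  simp only [entryFactor]
  split_ifs with h h'
  · rfl
  · simp
  · rw [Finset.sum_boole, Nat.card_eq_fintype_card, Fintype.card_subtype]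

/-! ### The trivial character -/

/-- The fibres of a surjective homomorphism all have the same size. -/
lemma sum_comp_of_surjective {A B : Type*} [AddGroup A] [AddGroup B] [Fintype A] [Fintype B]
    (f : A →+ B) (hf : Function.Surjective f) (P : B → ℂ) :
    (Fintype.card B : ℂ) * ∑ a, P (f a) = Fintype.card A * ∑ b, P b := by
  classical
  have hfib : ∀ b : B, #{a | f a = b} = #{a | f a = 0} := fun b =>
    AddMonoidHom.card_fiber_eq_of_mem_range f (hf b) ⟨0, map_zero f⟩
  have h1 : ∑ a, P (f a) = #{a | f a = 0} * ∑ b, P b := by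
    rw [← Finset.sum_fiberwise (g := f), Finset.mul_sum]
    refine Finset.sum_congr rfl fun b _ => ?_
    rw [← hfib b, Finset.sum_congr rfl (g := fun _ => P b) (fun a ha => by
      rw [(Finset.mem_filter.mp ha).2])]
    simp
  have h2 : Fintype.card A = Fintype.card B * #{a | f a = 0} := by
    rw [← Finset.card_univ, Finset.card_eq_sum_card_fiberwise (f := f) (t := univ) (by simp)]
    simp [hfib]
  rw [h1, h2]; push_cast; ring

lemma traceCharSum_one_eq_card (r : ℕ) :
    traceCharSum r (1 : AddChar R ℂ) = Nat.card (Matrix.GeneralLinearGroup (Fin r) R) := by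
  classical
  rw [traceCharSum]
  simp only [AddChar.one_apply]
  rw [Finset.sum_boole, ← Fintype.card_subtype, ← Nat.card_eq_fintype_card]
  congr 1
  refine Nat.card_congr (Equiv.ofBijective (fun u => ⟨u.1, Matrix.isUnits_det_units u⟩) ?_).symm
  refine ⟨fun u v h => Units.ext (congrArg Subtype.val h), fun X => ?_⟩
  exact ⟨((Matrix.isUnit_iff_isUnit_det _).mpr X.2).unit, rfl⟩

lemma card_pow_sq_eq (K : Type*) [Fintype K] (r : ℕ) :
    (Nat.card K : ℂ) ^ (r ^ 2) = Fintype.card (Matrix (Fin r) (Fin r) K) := by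
  rw [← Nat.card_eq_fintype_card, Matrix, Nat.card_fun, Nat.card_fun]
  simp [sq, pow_mul]

/-- Invertibility of the determinant is detected after applying `f`, and entrywise reduction has
fibres of equal size. -/
lemma traceCharSum_one [Fintype k] (f : R →+* k) [IsLocalHom f] (hf : Function.Surjective f)
    (r : ℕ) :
    (Nat.card k : ℂ) ^ (r ^ 2) * traceCharSum r (1 : AddChar R ℂ) =
      Nat.card R ^ (r ^ 2) * Nat.card (Matrix.GeneralLinearGroup (Fin r) k) := by
  classical
  rw [← traceCharSum_one_eq_card]
  have := sum_comp_of_surjective (f.toAddMonoidHom.mapMatrix (m := Fin r) (n := Fin r))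
    (fun X => ⟨X.map (Function.surjInv hf), by
      ext i j; simp [Function.surjInv_eq hf]⟩)
    (fun X => if IsUnit X.det then (1 : ℂ) else 0)
  simp only [traceCharSum, AddChar.one_apply]
  rw [card_pow_sq_eq, card_pow_sq_eq]
  convert this using 2
  · refine Finset.sum_congr rfl fun X _ => ?_
    have : IsUnit X.det ↔ IsUnit (f.toAddMonoidHom.mapMatrix X).det := by
      rw [← isUnit_map_iff f, RingHom.map_det]; rfl
    simp only [this]

/-! ### Transport along isomorphisms and products -/

lemma traceCharSum_ringEquiv (e : R ≃+* S) (ψ : AddChar S ℂ) (r : ℕ) :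
    traceCharSum r (ψ.compAddMonoidHom (e : R →+ S)) = traceCharSum r ψ := by
  classical
  rw [traceCharSum, traceCharSum, ← Equiv.sum_comp e.toEquiv.mapMatrix]
  refine Finset.sum_congr rfl fun X _ => ?_
  have h1 : IsUnit (e.toEquiv.mapMatrix X).det ↔ IsUnit X.det := by
    rw [← isUnit_map_iff e X.det, RingEquiv.map_det]; rfl
  have h2 : (e.toEquiv.mapMatrix X).trace = e X.trace := by
    simp [Matrix.trace]
  simp only [h1, h2]; rfl

lemma unitCharSum_ringEquiv (e : R ≃+* S) (ψ : AddChar S ℂ) :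
    unitCharSum (ψ.compAddMonoidHom (e : R →+ S)) = unitCharSum ψ := by
  classical
  rw [unitCharSum, unitCharSum, ← Equiv.sum_comp e.toEquiv]
  refine Finset.sum_congr rfl fun x _ => ?_
  have h1 : IsUnit (e.toEquiv x) ↔ IsUnit x := isUnit_map_iff e x
  simp only [h1]; rfl

lemma card_kernelIdeal_ringEquiv {R S : Type*} [CommRing R] [CommRing S] (e : R ≃+* S)
    (ψ : AddChar S ℂ) :
    Nat.card (ψ.compAddMonoidHom (e : R →+ S)).kernelIdeal = Nat.card ψ.kernelIdeal := by
  refine Nat.card_congr (e.toEquiv.subtypeEquiv fun a => ?_)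
  rw [AddChar.mem_kernelIdeal, AddChar.mem_kernelIdeal]
  rw [e.surjective.forall]
  simp

/-- Matrices over a product ring are pairs of matrices. -/
def matrixProdEquiv (R S : Type*) (r : ℕ) :
    Matrix (Fin r) (Fin r) (R × S) ≃ Matrix (Fin r) (Fin r) R × Matrix (Fin r) (Fin r) S where
  toFun X := (X.map Prod.fst, X.map Prod.snd)
  invFun Y := Matrix.of fun i j => (Y.1 i j, Y.2 i j)
  left_inv X := by ext <;> rfl
  right_inv Y := by ext <;> rfl

lemma AddChar.apply_eq_inl_mul_inr {R S : Type*} [CommRing R] [CommRing S] (ψ : AddChar (R × S) ℂ) (x : R × S) :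
    ψ x = ψ.compAddMonoidHom (AddMonoidHom.inl R S) x.1 *
      ψ.compAddMonoidHom (AddMonoidHom.inr R S) x.2 := by
  rw [compAddMonoidHom_apply, compAddMonoidHom_apply, ← map_add_eq_mul]
  simp

lemma traceCharSum_prod (ψ : AddChar (R × S) ℂ) (r : ℕ) :
    traceCharSum r ψ = traceCharSum r (ψ.compAddMonoidHom (AddMonoidHom.inl R S)) *
      traceCharSum r (ψ.compAddMonoidHom (AddMonoidHom.inr R S)) := by
  classical
  simp only [traceCharSum]
  rw [Finset.sum_mul_sum, ← Finset.sum_product', Finset.univ_product_univ,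
    ← Equiv.sum_comp (matrixProdEquiv R S r)]
  refine Finset.sum_congr rfl fun X _ => ?_
  have h1 : X.det = ((matrixProdEquiv R S r X).1.det, (matrixProdEquiv R S r X).2.det) :=
    Prod.ext ((RingHom.fst R S).map_det X) ((RingHom.snd R S).map_det X)
  have h2 : X.trace = ((matrixProdEquiv R S r X).1.trace, (matrixProdEquiv R S r X).2.trace) := by
    ext
    · simp [Matrix.trace, matrixProdEquiv, Prod.fst_sum]
    · simp [Matrix.trace, matrixProdEquiv, Prod.snd_sum]
  simp only [h1, h2, ψ.apply_eq_inl_mul_inr, Prod.isUnit_iff]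
  split_ifs <;> simp_all

lemma unitCharSum_prod (ψ : AddChar (R × S) ℂ) :
    unitCharSum ψ = unitCharSum (ψ.compAddMonoidHom (AddMonoidHom.inl R S)) *
      unitCharSum (ψ.compAddMonoidHom (AddMonoidHom.inr R S)) := by
  classical
  simp only [unitCharSum]
  rw [Finset.sum_mul_sum, ← Finset.sum_product', Finset.univ_product_univ]
  refine Finset.sum_congr rfl fun x _ => ?_
  simp only [ψ.apply_eq_inl_mul_inr x, Prod.isUnit_iff]
  split_ifs <;> simp_all

lemma card_kernelIdeal_prod {R S : Type*} [CommRing R] [CommRing S] (ψ : AddChar (R × S) ℂ) :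
    Nat.card ψ.kernelIdeal =
      Nat.card (ψ.compAddMonoidHom (AddMonoidHom.inl R S)).kernelIdeal *
        Nat.card (ψ.compAddMonoidHom (AddMonoidHom.inr R S)).kernelIdeal := by
  rw [← Nat.card_prod]
  refine Nat.card_congr (Equiv.trans (Equiv.subtypeEquivRight fun a => ?_)
    (Equiv.subtypeProdEquivProd (p := fun a => a ∈ (ψ.compAddMonoidHom (AddMonoidHom.inl R S)).kernelIdeal)
      (q := fun a => a ∈ (ψ.compAddMonoidHom (AddMonoidHom.inr R S)).kernelIdeal)))
  simp only [AddChar.mem_kernelIdeal]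
  constructor
  · intro h
    refine ⟨fun x => ?_, fun x => ?_⟩
    · simpa [Prod.mul_def] using h (x, 0)
    · simpa [Prod.mul_def] using h (0, x)
  · rintro ⟨h1, h2⟩ x
    rw [ψ.apply_eq_inl_mul_inr, Prod.fst_mul, Prod.snd_mul, h1, h2, one_mul]

end TraceSum

/-! ### Prime powers, then general moduli -/

/-- The factor contributed by a prime `p` modulo which the character is trivial. -/
noncomputable def invertibilityFactor (r p : ℕ) : ℂ :=
  ∏ i ∈ Finset.Icc 1 r, ((1 - (p : ℂ) ^ (-(i : ℤ))) / (1 - (p : ℂ) ^ (-1 : ℤ)))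

lemma card_GL_zmod_prime (p r : ℕ) [hp : Fact p.Prime] :
    (Nat.card (Matrix.GeneralLinearGroup (Fin r) (ZMod p)) : ℂ) =
      (p : ℂ) ^ (r ^ 2) * ∏ i ∈ Finset.Icc 1 r, (1 - (p : ℂ) ^ (-(i : ℤ))) := by
  have hp0 : (p : ℂ) ≠ 0 := by exact_mod_cast hp.out.ne_zero
  rw [Matrix.card_GL_field, ZMod.card, Fin.prod_univ_eq_prod_range (fun i => p ^ r - p ^ i) r,
    ← Finset.prod_range_reflect]
  have h1 : ∏ i ∈ Finset.Icc 1 r, (1 - (p : ℂ) ^ (-(i : ℤ))) =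
      ∏ i ∈ Finset.range r, (1 - (p : ℂ) ^ (-((i + 1 : ℕ) : ℤ))) := by
    rw [Finset.range_eq_Ico, Finset.prod_Ico_add' (fun i : ℕ => (1 - (p : ℂ) ^ (-(i : ℤ)))) 0 r 1]
    rfl
  have h2 : (p : ℂ) ^ (r ^ 2) = ∏ _i ∈ Finset.range r, (p : ℂ) ^ r := by
    rw [Finset.prod_const, Finset.card_range, ← pow_mul, sq]
  rw [h1, h2, ← Finset.prod_mul_distrib, Nat.cast_prod]
  refine Finset.prod_congr rfl fun i hi => ?_
  have hi' : i + 1 ≤ r := Finset.mem_range.mp hi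
  have h3 : r - 1 - i = r - (i + 1) := by omega
  rw [h3, Nat.cast_sub (Nat.pow_le_pow_right hp.out.pos (Nat.sub_le _ _)), mul_sub, mul_one,
    Nat.cast_pow, Nat.cast_pow, zpow_neg, zpow_natCast, pow_sub₀ _ hp0 hi']

lemma unitCharSum_one_zmod (n : ℕ) [NeZero n] :
    unitCharSum (1 : AddChar (ZMod n) ℂ) = Nat.totient n := by
  classical
  have h : unitCharSum (1 : AddChar (ZMod n) ℂ) = #{x : ZMod n | IsUnit x} := by
    rw [Finset.card_filter]
    push_cast
    exact Finset.sum_congr rfl fun x _ => by congr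
  rw [h, ← ZMod.card_units_eq_totient, ← Fintype.card_subtype,
    ← Nat.card_eq_fintype_card, ← Nat.card_eq_fintype_card]
  congr 1
  refine Nat.card_congr (Equiv.ofBijective (fun u => ⟨u.1, u.isUnit⟩) ?_).symm
  exact ⟨fun u v h => Units.ext (congrArg Subtype.val h), fun X => ⟨X.2.unit, rfl⟩⟩

lemma add_two_mul_choose_two (r : ℕ) : r + 2 * r.choose 2 = r ^ 2 := by
  induction r with
  | zero => simp
  | succ r ih => rw [Nat.choose_succ_succ' r 1, Nat.choose_one_right]; nlinarith

lemma isLocalHom_castHom_prime_pow {p k : ℕ} (hp : p.Prime) (hk : k ≠ 0) :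
    IsLocalHom (ZMod.castHom (dvd_pow_self p hk) (ZMod p)) := by
  have : NeZero (p ^ k) := ⟨pow_ne_zero _ hp.ne_zero⟩
  refine ⟨fun a ha => ?_⟩
  rw [← ZMod.natCast_zmod_val a, map_natCast, ZMod.isUnit_iff_coprime] at ha
  rw [← ZMod.natCast_zmod_val a, ZMod.isUnit_iff_coprime]
  exact ha.pow_right k

lemma card_kernelIdeal_one (R : Type*) [CommRing R] :
    Nat.card (1 : AddChar R ℂ).kernelIdeal = Nat.card R := by
  have : (1 : AddChar R ℂ).kernelIdeal = ⊤ := by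
    ext; simp [AddChar.mem_kernelIdeal]
  rw [this]
  exact Nat.card_congr (Equiv.subtypeUnivEquiv fun _ => Submodule.mem_top)

lemma card_kernelIdeal_dvd {n : ℕ} (ψ : AddChar (ZMod n) ℂ) :
    Nat.card ψ.kernelIdeal ∣ n := by
  simpa using AddSubgroup.card_addSubgroup_dvd_card ψ.kernelIdeal.toAddSubgroup

lemma eq_one_of_card_kernelIdeal {n : ℕ} [NeZero n] {ψ : AddChar (ZMod n) ℂ}
    (h : Nat.card ψ.kernelIdeal = n) : ψ = 1 := by
  have : ψ.kernelIdeal.toAddSubgroup = ⊤ := by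
    apply AddSubgroup.eq_top_of_card_eq
    rw [Nat.card_zmod]; exact h
  have h1 : (1 : ZMod n) ∈ ψ.kernelIdeal.toAddSubgroup := by rw [this]; trivial
  ext x
  simpa using AddChar.mem_kernelIdeal.mp h1 x

lemma traceCharSum_zmod_prime_pow {p k : ℕ} (hp : p.Prime) (hk : 0 < k) [NeZero (p ^ k)]
    (r : ℕ) (ψ : AddChar (ZMod (p ^ k)) ℂ) :
    traceCharSum r ψ = unitCharSum ψ ^ r *
      (((p ^ k : ℕ) : ℂ) * Nat.card ψ.kernelIdeal) ^ r.choose 2 *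
      ∏ q ∈ (p ^ k).primeFactors.filter (fun q => ¬ q ∣ p ^ k / Nat.card ψ.kernelIdeal),
        invertibilityFactor r q := by
  have : Fact p.Prime := ⟨hp⟩
  have := isLocalHom_castHom_prime_pow hp hk.ne'
  set f := ZMod.castHom (dvd_pow_self p hk.ne') (ZMod p)
  have hp0 : (p : ℂ) ≠ 0 := by exact_mod_cast hp.ne_zero
  rw [Nat.primeFactors_prime_pow hk.ne' hp]
  by_cases hψ : ψ = 1
  · subst hψ
    have h := traceCharSum_one f (ZMod.castHom_surjective _) r
    rw [card_GL_zmod_prime, Nat.card_zmod, Nat.card_zmod, mul_left_comm] at h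
    have h' := mul_left_cancel₀ (pow_ne_zero _ hp0) h
    have hfil : ({p} : Finset ℕ).filter (fun q => ¬ q ∣ p ^ k / p ^ k) = {p} := by
      rw [Nat.div_self (pow_pos hp.pos _), Finset.filter_singleton, if_pos]
      exact fun h => hp.one_lt.ne' (Nat.dvd_one.mp h)
    have h1p : (1 - (p : ℂ) ^ (-1 : ℤ)) ≠ 0 := by
      rw [sub_ne_zero, zpow_neg_one]
      intro h
      have := inv_eq_one.mp h.symm
      exact hp.one_lt.ne' (by exact_mod_cast this)
    have htot : (Nat.totient (p ^ k) : ℂ) = (p : ℂ) ^ k * (1 - (p : ℂ) ^ (-1 : ℤ)) := by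
      obtain ⟨m, rfl⟩ := Nat.exists_eq_succ_of_ne_zero hk.ne'
      rw [Nat.totient_prime_pow_succ hp, Nat.cast_mul, Nat.cast_sub hp.one_le, zpow_neg_one]
      push_cast
      rw [pow_succ]
      field_simp
    rw [h', card_kernelIdeal_one, Nat.card_zmod, hfil, Finset.prod_singleton, invertibilityFactor,
      Finset.prod_div_distrib, Finset.prod_const, Nat.card_Icc, Nat.add_sub_cancel,
      unitCharSum_one_zmod, htot, ← add_two_mul_choose_two r, mul_pow, pow_add, pow_mul]
    generalize 1 - (p : ℂ) ^ (-1 : ℤ) = u at h1p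
    push_cast
    field_simp
  -- A proper kernel ideal has order `p ^ j` with `j < k`, so `p` divides the quotient and the last
  -- product is empty.
  · rw [traceCharSum_of_ne_one f hψ, Nat.card_zmod, Finset.filter_false_of_mem, Finset.prod_empty,
      mul_one]
    intro q hq
    rw [Finset.mem_singleton] at hq
    subst hq
    rw [not_not]
    obtain ⟨j, hj, hI⟩ := (Nat.dvd_prime_pow hp).mp (card_kernelIdeal_dvd ψ)
    have hjk : j ≠ k := by
      rintro rfl
      exact hψ (eq_one_of_card_kernelIdeal hI)
    rw [hI, Nat.pow_div hj hp.pos]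
    exact dvd_pow_self _ (by omega)

/-- A prime dividing `a` cannot divide `b / e`, so the divisibility condition is local to each
factor. -/
lemma prod_primeFactors_filter_mul {a b d e : ℕ} (hab : a.Coprime b)
    (hd : d ∣ a) (he : e ∣ b) (F : ℕ → ℂ) :
    ∏ q ∈ (a * b).primeFactors.filter (fun q => ¬ q ∣ a * b / (d * e)), F q =
      (∏ q ∈ a.primeFactors.filter (fun q => ¬ q ∣ a / d), F q) *
        ∏ q ∈ b.primeFactors.filter (fun q => ¬ q ∣ b / e), F q := by
  rw [Nat.Coprime.primeFactors_mul hab, Finset.filter_union, Finset.prod_union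
    (Finset.disjoint_filter_filter hab.disjoint_primeFactors), Nat.mul_div_mul_comm hd he]
  have key : ∀ {a b d e : ℕ}, a.Coprime b → d ∣ a → e ∣ b →
      a.primeFactors.filter (fun q => ¬ q ∣ a / d * (b / e)) =
        a.primeFactors.filter (fun q => ¬ q ∣ a / d) := by
    intro a b d e hab hd he
    refine Finset.filter_congr fun q hq => not_congr ?_
    have hqp := Nat.prime_of_mem_primeFactors hq
    rw [hqp.dvd_mul, or_iff_left]
    intro h
    exact hqp.one_lt.ne' (Nat.Coprime.eq_one_of_dvd
      (hab.coprime_dvd_left (Nat.dvd_of_mem_primeFactors hq))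
      (h.trans (Nat.div_dvd_of_dvd he)))
  rw [key hab hd he, mul_comm (a / d), key hab.symm he hd]

/-- The sum over `GL_r(ℤ/nℤ)` of an additive character of the trace. -/
theorem traceCharSum_zmod (n : ℕ) [NeZero n] (r : ℕ) (ψ : AddChar (ZMod n) ℂ) :
    traceCharSum r ψ = unitCharSum ψ ^ r *
      ((n : ℂ) * Nat.card ψ.kernelIdeal) ^ r.choose 2 *
      ∏ q ∈ n.primeFactors.filter (fun q => ¬ q ∣ n / Nat.card ψ.kernelIdeal),
        invertibilityFactor r q := by
  revert ψ
  rename_i hn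
  revert hn
  induction n using Nat.recOnPosPrimePosCoprime with
  | prime_pow p k hp hk => intro _ ψ; exact traceCharSum_zmod_prime_pow hp hk r ψ
  | zero => intro hn; exact absurd rfl hn.out
  | one =>
    classical
    intro _ ψ
    have : Subsingleton (ZMod 1) := inferInstanceAs (Subsingleton (Fin 1))
    have h1 : ∀ x, ψ x = 1 := fun x => by rw [Subsingleton.elim x 0, AddChar.map_zero_eq_one]
    have h2 : Nat.card ψ.kernelIdeal = 1 := Nat.dvd_one.mp (card_kernelIdeal_dvd ψ)
    have h3 : traceCharSum r ψ = 1 := by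
      have : Subsingleton (Matrix (Fin r) (Fin r) (ZMod 1)) :=
        inferInstanceAs (Subsingleton (Fin r → Fin r → ZMod 1))
      rw [traceCharSum, Fintype.sum_subsingleton _ 1, if_pos (by simp), h1]
    have h4 : unitCharSum ψ = 1 := by
      rw [unitCharSum, Fintype.sum_subsingleton _ 1, if_pos isUnit_one, h1]
    rw [h3, h4, h2]
    simp
  | coprime a b ha hb hab iha ihb =>
    intro _ ψ
    have : NeZero a := ⟨by omega⟩
    have : NeZero b := ⟨by omega⟩
    set e := ZMod.chineseRemainder hab
    obtain ⟨φ, rfl⟩ : ∃ φ : AddChar (ZMod a × ZMod b) ℂ,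
        ψ = φ.compAddMonoidHom (e : ZMod (a * b) →+ ZMod a × ZMod b) :=
      ⟨ψ.compAddMonoidHom (e.symm : ZMod a × ZMod b →+ ZMod (a * b)), by ext; simp⟩
    rw [traceCharSum_ringEquiv, unitCharSum_ringEquiv, card_kernelIdeal_ringEquiv,
      traceCharSum_prod, unitCharSum_prod, card_kernelIdeal_prod, iha, ihb,
      prod_primeFactors_filter_mul hab (card_kernelIdeal_dvd _)
        (card_kernelIdeal_dvd _)]
    push_cast
    ring

/-! ### Gcd classes and Ramanujan sums -/

lemma sum_zmod_eq_sum_range {n : ℕ} [NeZero n] (f : ZMod n → ℂ) :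
    ∑ x, f x = ∑ k ∈ Finset.range n, f k := by
  refine Finset.sum_nbij' (fun x => x.val) (fun k => (k : ZMod n)) ?_ ?_ ?_ ?_ ?_
  · intro x _; exact Finset.mem_range.mpr (ZMod.val_lt x)
  · intro k _; exact mem_univ _
  · intro x _; exact ZMod.natCast_zmod_val x
  · intro k hk; exact ZMod.val_cast_of_lt (Finset.mem_range.mp hk)
  · intro x _; rw [ZMod.natCast_zmod_val]

lemma unitCharSum_stdAddChar_mulShift_intCast {n : ℕ} [NeZero n] (k : ℤ) :
    unitCharSum ((ZMod.stdAddChar (N := n)).mulShift (k : ZMod n)) = ramanujanSum n k := by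
  classical
  rw [unitCharSum, sum_zmod_eq_sum_range, ramanujanSum, Finset.sum_filter]
  refine Finset.sum_congr rfl fun j _ => ?_
  simp only [ZMod.isUnit_iff_coprime]
  refine if_congr Iff.rfl ?_ rfl
  have h := ZMod.stdAddChar_coe (N := n) (k * j)
  rw [AddChar.mulShift_apply, ← Int.cast_natCast j, ← Int.cast_mul, h]
  congr 1
  push_cast
  ring

lemma unitCharSum_mulShift_unit_mul {R : Type*} [CommRing R] [Fintype R] (ψ : AddChar R ℂ) {u : R}
    (hu : IsUnit u) (t : R) : unitCharSum (ψ.mulShift (u * t)) = unitCharSum (ψ.mulShift t) := by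
  classical
  obtain ⟨u, rfl⟩ := hu
  rw [unitCharSum, unitCharSum]
  conv_rhs => rw [← Equiv.sum_comp (Units.mulLeft u)]
  refine Finset.sum_congr rfl fun x _ => ?_
  simp only [Units.mulLeft_apply, Units.isUnit_units_mul, AddChar.mulShift_apply]
  rw [mul_left_comm t, mul_assoc]

lemma gcd_val_unit_mul {n : ℕ} [NeZero n] {u : ZMod n} (hu : IsUnit u) (t : ZMod n) :
    (u * t).val.gcd n = t.val.gcd n := by
  have h : u.val.Coprime n := by
    rwa [← ZMod.natCast_zmod_val u, ZMod.isUnit_iff_coprime] at hu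
  rw [ZMod.val_mul, (Nat.mod_modEq _ _).gcd_eq, Nat.Coprime.gcd_mul_left_cancel _ h]

lemma gcd_val_natCast {n d : ℕ} [NeZero n] (hd : d ∣ n) : (d : ZMod n).val.gcd n = d := by
  rw [ZMod.val_natCast, (Nat.mod_modEq _ _).gcd_eq, Nat.gcd_eq_left hd]

lemma exists_isUnit_mul_gcd {n : ℕ} [NeZero n] (t : ZMod n) :
    ∃ u : ZMod n, IsUnit u ∧ t = u * (t.val.gcd n : ℕ) := by
  obtain ⟨d, hd, u, hu, ht⟩ := t.eq_unit_mul_divisor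
  refine ⟨u, hu, ?_⟩
  have : t.val.gcd n = d := by rw [ht, gcd_val_unit_mul hu, gcd_val_natCast hd]
  rw [this, ← ht]

lemma unitCharSum_stdAddChar_mulShift {n : ℕ} [NeZero n] (t : ZMod n) :
    unitCharSum ((ZMod.stdAddChar (N := n)).mulShift t) = ramanujanSum n (t.val.gcd n : ℕ) := by
  obtain ⟨u, hu, ht⟩ := exists_isUnit_mul_gcd t
  conv_lhs => rw [ht]
  rw [unitCharSum_mulShift_unit_mul _ hu, ← unitCharSum_stdAddChar_mulShift_intCast,
    Int.cast_natCast]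

lemma mem_kernelIdeal_mulShift {R : Type*} [CommRing R] {ψ : AddChar R ℂ}
    (hψ : ψ.IsPrimitive) (t a : R) : a ∈ (ψ.mulShift t).kernelIdeal ↔ a * t = 0 := by
  rw [AddChar.mem_kernelIdeal]
  constructor
  · intro h
    by_contra hne
    apply hψ hne
    ext x
    have := h x
    rw [AddChar.mulShift_apply] at this
    rw [AddChar.mulShift_apply, AddChar.one_apply, ← this]
    congr 1
    ring
  · intro h x
    rw [AddChar.mulShift_apply, show t * (a * x) = a * t * x by ring, h, zero_mul,
      AddChar.map_zero_eq_one]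

lemma card_zmod_mul_natCast_eq_zero {n d : ℕ} [NeZero n] (hd : d ∣ n) :
    Nat.card {a : ZMod n // a * d = 0} = d := by
  classical
  obtain ⟨m, rfl⟩ := hd
  have hd0 : 0 < d := Nat.pos_of_ne_zero fun h => NeZero.ne (d * m) (by simp [h])
  have hm0 : 0 < m := Nat.pos_of_ne_zero fun h => NeZero.ne (d * m) (by simp [h])
  have key : ∀ a : ZMod (d * m), a * d = 0 ↔ m ∣ a.val := by
    intro a
    have h : a * d = ((d * a.val : ℕ) : ZMod (d * m)) := by
      rw [Nat.cast_mul, ZMod.natCast_zmod_val, mul_comm a]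
    rw [h, ZMod.natCast_eq_zero_iff, Nat.mul_dvd_mul_iff_left hd0]
  have hlt : ∀ i : Fin d, m * i < d * m := fun i => by
    rw [mul_comm d]; exact Nat.mul_lt_mul_of_pos_left i.2 hm0
  refine (Nat.card_congr (Equiv.ofBijective
    (fun i : Fin d => (⟨((m * i : ℕ) : ZMod (d * m)), ?_⟩ : {a : ZMod (d * m) // a * d = 0})) ⟨?_, ?_⟩)).symm.trans (Nat.card_fin d)
  · rw [key, ZMod.val_cast_of_lt (hlt i)]
    exact dvd_mul_right _ _
  · intro i j hij
    have := congrArg ZMod.val (congrArg Subtype.val hij)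
    simp only [ZMod.val_cast_of_lt (hlt _)] at this
    exact Fin.ext (Nat.eq_of_mul_eq_mul_left hm0 this)
  · rintro ⟨a, ha⟩
    obtain ⟨i, hi⟩ := (key a).mp ha
    have hid : i < d := by
      have := ZMod.val_lt a
      rw [hi, mul_comm d] at this
      exact lt_of_mul_lt_mul_left this hm0.le
    refine ⟨⟨i, hid⟩, Subtype.ext ?_⟩
    simp only [← hi, ZMod.natCast_zmod_val]

/-- Primitivity makes the kernel ideal the annihilator of `t`, and `t` is a unit multiple of its gcd
with `n`. -/
lemma card_kernelIdeal_stdAddChar_mulShift {n : ℕ} [NeZero n] (t : ZMod n) :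
    Nat.card ((ZMod.stdAddChar (N := n)).mulShift t).kernelIdeal = t.val.gcd n := by
  rw [← card_zmod_mul_natCast_eq_zero (Nat.gcd_dvd_right t.val n)]
  refine Nat.card_congr (Equiv.subtypeEquivRight fun a => ?_)
  rw [mem_kernelIdeal_mulShift (ZMod.isPrimitive_stdAddChar n)]
  obtain ⟨u, hu, ht⟩ := exists_isUnit_mul_gcd t
  conv_lhs => rw [ht]
  rw [mul_left_comm, hu.mul_right_eq_zero]

lemma card_filter_gcd_val {n d : ℕ} [NeZero n] (hd : d ∣ n) :
    #{t : ZMod n | t.val.gcd n = d} = Nat.totient (n / d) := by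
  have h : ((#{t : ZMod n | t.val.gcd n = d} : ℕ) : ℂ) = Nat.totient (n / d) := by
    rw [Nat.totient_div_of_dvd hd, ← Finset.sum_boole, ← Finset.sum_boole, sum_zmod_eq_sum_range]
    refine Finset.sum_congr rfl fun k hk => ?_
    rw [ZMod.val_cast_of_lt (Finset.mem_range.mp hk), Nat.gcd_comm]
  exact_mod_cast h

/-- Averaging over the units: the sum of `exp(2πi ts / n)` over the residues `t` with
`gcd(t, n) = d`. -/
lemma totient_mul_sum_gcd_eq {n d : ℕ} [NeZero n] (hd : d ∣ n) (s : ZMod n) :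
    (Nat.totient n : ℂ) * ∑ t : ZMod n with t.val.gcd n = d, ZMod.stdAddChar (t * s) =
      Nat.totient (n / d) * unitCharSum ((ZMod.stdAddChar (N := n)).mulShift (d * s)) := by
  classical
  have h1 : ∀ u : ZMod n, IsUnit u →
      ∑ t : ZMod n with t.val.gcd n = d, ZMod.stdAddChar (t * s) =
        ∑ t : ZMod n with t.val.gcd n = d, ZMod.stdAddChar (t * s * u) := by
    rintro _ ⟨u, rfl⟩
    rw [Finset.sum_filter, Finset.sum_filter, ← Equiv.sum_comp (Units.mulLeft u)]
    refine Finset.sum_congr rfl fun t _ => ?_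
    rw [Units.mulLeft_apply, gcd_val_unit_mul u.isUnit, show ↑u * t * s = t * s * u by ring]
  have h2 : ∀ t : ZMod n, t.val.gcd n = d →
      unitCharSum ((ZMod.stdAddChar (N := n)).mulShift (t * s)) =
        unitCharSum ((ZMod.stdAddChar (N := n)).mulShift (d * s)) := by
    intro t ht
    obtain ⟨u, hu, htu⟩ := exists_isUnit_mul_gcd t
    rw [ht] at htu
    rw [htu, mul_assoc, unitCharSum_mulShift_unit_mul _ hu]
  -- Both totients are written as counts, turning each side into a double sum over units `u` and
  -- residues `t` of gcd `d`.
  rw [← unitCharSum_one_zmod, unitCharSum, Finset.sum_mul, ← card_filter_gcd_val hd,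
    ← nsmul_eq_mul, ← Finset.sum_const]
  rw [Finset.sum_congr rfl fun t ht => (h2 t (Finset.mem_filter.mp ht).2).symm]
  simp only [unitCharSum]
  rw [Finset.sum_comm]
  refine Finset.sum_congr rfl fun u _ => ?_
  by_cases hu : IsUnit u
  · simp only [if_pos hu, AddChar.one_apply, one_mul, AddChar.mulShift_apply]
    exact h1 u hu
  · simp [hu]

/-- The residues with gcd `l` are the `l * j` with `j` prime to `n / l`; for `l = n` this is the
single residue `0`, with `j = 0`. -/
lemma ramanujanSum_div_eq_sum_gcd {n l : ℕ} [NeZero n] (hl : l ∣ n) (d : ℕ) :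
    ramanujanSum (n / l) d =
      ∑ t : ZMod n with t.val.gcd n = l, ZMod.stdAddChar (t * (d : ZMod n)) := by
  obtain ⟨m, rfl⟩ := hl
  have hl0 : 0 < l := Nat.pos_of_ne_zero fun h => NeZero.ne (l * m) (by simp [h])
  have hm0 : 0 < m := Nat.pos_of_ne_zero fun h => NeZero.ne (l * m) (by simp [h])
  have hlt : ∀ {j}, j < m → l * j < l * m := fun h => Nat.mul_lt_mul_of_pos_left h hl0
  rw [Nat.mul_div_cancel_left _ hl0, ramanujanSum]
  refine Finset.sum_bij (fun j _ => ((l * j : ℕ) : ZMod (l * m))) ?_ ?_ ?_ ?_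
  · intro j hj
    rw [Finset.mem_filter, Finset.mem_range] at hj
    rw [Finset.mem_filter, ZMod.val_cast_of_lt (hlt hj.1), Nat.gcd_mul_left, hj.2.gcd_eq_one]
    exact ⟨mem_univ _, mul_one l⟩
  · intro i hi j hj hij
    rw [Finset.mem_filter, Finset.mem_range] at hi hj
    have := congrArg ZMod.val hij
    rw [ZMod.val_cast_of_lt (hlt hi.1), ZMod.val_cast_of_lt (hlt hj.1)] at this
    exact Nat.eq_of_mul_eq_mul_left hl0 this
  · intro t ht
    have ht' := (Finset.mem_filter.mp ht).2
    obtain ⟨j, hj⟩ : l ∣ t.val := (dvd_of_eq ht'.symm).trans (Nat.gcd_dvd_left _ _)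
    refine ⟨j, ?_, by rw [← hj, ZMod.natCast_zmod_val]⟩
    have h1 := ZMod.val_lt t
    rw [hj] at h1
    rw [hj, Nat.gcd_mul_left] at ht'
    exact Finset.mem_filter.mpr ⟨Finset.mem_range.mpr (lt_of_mul_lt_mul_left h1 hl0.le),
      Nat.eq_of_mul_eq_mul_left hl0 (ht'.trans (mul_one l).symm)⟩
  · intro j _
    have h := ZMod.stdAddChar_coe (N := l * m) ((l * j * d : ℕ) : ℤ)
    rw [Int.cast_natCast, Nat.cast_mul] at h
    rw [h]
    congr 1
    have hlc : (l : ℂ) ≠ 0 := by exact_mod_cast hl0.ne'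
    have hmc : (m : ℂ) ≠ 0 := by exact_mod_cast hm0.ne'
    push_cast
    field_simp

/-- Unit averaging is used twice, on the class of `d` paired with `-β` and on the class of `l`
paired with `d`. Since `-dβ` is a unit multiple of `ld`, both give the same unit sum, which is
eliminated. -/
lemma sum_gcd_eq_ramanujanSum {n d : ℕ} [NeZero n] (hd : d ∣ n) (β : ZMod n) :
    ∑ t : ZMod n with t.val.gcd n = d, ZMod.stdAddChar (t * -β) =
      1 / (Nat.totient (n / β.val.gcd n) : ℂ) * (ramanujanSum (n / β.val.gcd n) d *
        Nat.totient (n / d)) := by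
  have hl : β.val.gcd n ∣ n := Nat.gcd_dvd_right _ _
  obtain ⟨u, hu, hβ⟩ := exists_isUnit_mul_gcd β
  set l := β.val.gcd n
  have hn0 : 0 < n := Nat.pos_of_ne_zero (NeZero.ne n)
  have hφ : (Nat.totient n : ℂ) ≠ 0 := by exact_mod_cast (Nat.totient_pos.mpr hn0).ne'
  have hφl : (Nat.totient (n / l) : ℂ) ≠ 0 := by
    exact_mod_cast (Nat.totient_pos.mpr (Nat.div_pos (Nat.le_of_dvd hn0 hl)
      (Nat.pos_of_dvd_of_pos hl hn0))).ne'
  have h1 := totient_mul_sum_gcd_eq hd (-β)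
  have h2 := totient_mul_sum_gcd_eq hl (d : ZMod n)
  rw [← ramanujanSum_div_eq_sum_gcd hl] at h2
  have h3 : (d : ZMod n) * -β = -u * (l * d) := by rw [hβ]; ring
  rw [h3, unitCharSum_mulShift_unit_mul _ hu.neg] at h1
  apply mul_left_cancel₀ hφ
  rw [h1]
  field_simp
  linear_combination -(Nat.totient (n / d) : ℂ) * h2

/-! ### Fourier inversion and assembly -/

lemma mul_numGLWithTrace (r n : ℕ) [NeZero n] (β : ZMod n) :
    (n : ℂ) * numGLWithTrace r n β = ∑ t : ZMod n, ZMod.stdAddChar (t * -β) *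
      traceCharSum r ((ZMod.stdAddChar (N := n)).mulShift t) := by
  classical
  have h1 : (numGLWithTrace r n β : ℂ) = ∑ X : Matrix (Fin r) (Fin r) (ZMod n),
      if IsUnit X.det then (if X.trace - β = 0 then 1 else 0) else 0 := by
    simp_rw [← ite_and]
    rw [Finset.sum_boole, ← Fintype.card_subtype, ← Nat.card_eq_fintype_card, numGLWithTrace]
    congr 1
    refine Nat.card_congr (Equiv.ofBijective
      (fun u => ⟨u.1.1, Matrix.isUnits_det_units u.1, sub_eq_zero.mpr u.2⟩) ?_)
    refine ⟨fun u v h => Subtype.ext (Units.ext (congrArg Subtype.val h)), fun X => ?_⟩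
    exact ⟨⟨((Matrix.isUnit_iff_isUnit_det _).mpr X.2.1).unit, sub_eq_zero.mp X.2.2⟩, rfl⟩
  rw [h1, Finset.mul_sum]
  simp only [traceCharSum, Finset.mul_sum]
  rw [Finset.sum_comm]
  refine Finset.sum_congr rfl fun X _ => ?_
  by_cases hX : IsUnit X.det
  · simp only [if_pos hX]
    have h := AddChar.sum_mulShift (X.trace - β) (ZMod.isPrimitive_stdAddChar n)
    rw [ZMod.card] at h
    rw [mul_ite, mul_one, mul_zero]
    have h' : ∀ t : ZMod n, ZMod.stdAddChar (t * -β) *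
        (ZMod.stdAddChar (N := n)).mulShift t X.trace =
          ZMod.stdAddChar (N := n) (t * (X.trace - β)) := fun t => by
      rw [AddChar.mulShift_apply, ← AddChar.map_add_eq_mul]
      congr 1
      ring
    simp only [h', h, Nat.cast_ite, Nat.cast_zero]
  · simp [hX]

lemma int_mul_sub_one_div_two (r : ℕ) : (r : ℤ) * ((r : ℤ) - 1) / 2 = (r.choose 2 : ℕ) := by
  have h := add_two_mul_choose_two r
  have h' : (r : ℤ) * ((r : ℤ) - 1) = 2 * (r.choose 2 : ℕ) := by
    have : (r : ℤ) + 2 * (r.choose 2 : ℕ) = (r : ℤ) ^ 2 := by exact_mod_cast h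
    linarith
  rw [h', Int.mul_ediv_cancel_left _ (by norm_num)]

theorem theorem6 (r n : ℕ) [NeZero n] (β : ZMod n) (l : ℕ) (hl : l = Nat.gcd β.val n) :
    (numGLWithTrace r n β : ℂ) =
      1 / (Nat.totient (n / l) : ℂ) * (n : ℂ) ^ ((r : ℤ) * ((r : ℤ) - 1) / 2 - 1) *
        ∑ d ∈ n.divisors,
          ramanujanSum (n / l) (d : ℤ) * ramanujanSum n (d : ℤ) ^ r *
            (Nat.totient (n / d) : ℂ) * (d : ℂ) ^ ((r : ℤ) * ((r : ℤ) - 1) / 2) *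
            ∏ p ∈ n.primeFactors.filter (fun p => ¬ p ∣ n / d),
              ∏ i ∈ Finset.Icc 1 r,
                ((1 - (p : ℂ) ^ (-(i : ℤ))) / (1 - (p : ℂ) ^ (-1 : ℤ))) := by
  subst hl
  have hn : (n : ℂ) ≠ 0 := by exact_mod_cast NeZero.ne n
  apply mul_left_cancel₀ hn
  -- The `-1` in the exponent of `n` absorbs the factor from Fourier inversion. Frequencies `t` are
  -- grouped by gcd, `t = 0` falling under `d = n`.
  rw [mul_numGLWithTrace, int_mul_sub_one_div_two, zpow_sub_one₀ hn, zpow_natCast,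
    ← Finset.sum_fiberwise_of_maps_to (t := n.divisors) (g := fun t : ZMod n => t.val.gcd n)
      (fun t _ => Nat.mem_divisors.mpr ⟨Nat.gcd_dvd_right _ _, NeZero.ne n⟩),
    Finset.mul_sum, Finset.mul_sum]
  refine Finset.sum_congr rfl fun d hd => ?_
  have hdn := Nat.dvd_of_mem_divisors hd
  have key : ∀ t ∈ ({t : ZMod n | t.val.gcd n = d} : Finset (ZMod n)),
      ZMod.stdAddChar (t * -β) * traceCharSum r ((ZMod.stdAddChar (N := n)).mulShift t) =
        ZMod.stdAddChar (t * -β) * (ramanujanSum n d ^ r * ((n : ℂ) * d) ^ r.choose 2 *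
          ∏ q ∈ n.primeFactors.filter (fun q => ¬ q ∣ n / d), invertibilityFactor r q) := by
    intro t ht
    rw [traceCharSum_zmod, unitCharSum_stdAddChar_mulShift, card_kernelIdeal_stdAddChar_mulShift,
      (Finset.mem_filter.mp ht).2]
  rw [Finset.sum_congr rfl key, ← Finset.sum_mul, sum_gcd_eq_ramanujanSum hdn, zpow_natCast]
  simp only [invertibilityFactor]
  rw [mul_pow]
  field_simp
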